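/- Let $(X,\mu)$ be a standard Borel space with a $\sigma$-finite non-atomic measure, $\mu(X)=\infty$ (equivalently, $(X,\mu)$ is isomorphic to the real line with Lebesgue measure). Let $X_*$ be the space of configurations, that is, of countable subsets of $X$, with the $\sigma$-algebra generated by the functions $x_*\mapsto |x_*\cap A|$, $A\subset X$ measurable. Let $\mu_*$ be the Poisson measure on $X_*$ with intensity $\mu$: the probability measure such that for all pairwise disjoint measurable $A_1,\dots,A_N\subset X$ of finite measure and all integers $n_1,\dots,n_N\ge 0$ $$\mu_*\bigl(\{x_*:\ |x_*\cap A_i|=n_i,\ i=1,\dots,N\}\bigr)=\prod_{i=1}^N \frac{e^{-\mu(A_i)}\mu(A_i)^{n_i}}{n_i!}.$$ Let $T$ be an invertible measure-preserving transformation of $(X,\mu)$ and let $T_*(x_*)=\{Tx:\ x\in x_*\}$ be its Poisson suspension, which is an invertible transformation of $X_*$ preserving $\mu_*$. **Theorem (Roy).** If $T_*$ is mixing, i.e. $\mu_*(T_*^nV\cap W)\to\mu_*(V)\mu_*(W)$ as $n\to\infty$ for all measurable $V,W\subset X_*$, then $T_*$ is mixing of all orders: for every $k\ge 1$ and all measurable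 $A_0,A_1,\dots,A_k\subset X_*$, $$\mu_*\bigl(A_0\cap T_*^{n_1}A_1\cap T_*^{n_1+n_2}A_2\cap\dots\cap T_*^{n_1+\dots+n_k}A_k\bigr)\longrightarrow \prod_{i=0}^k\mu_*(A_i)\qquad\text{as } n_1,\dots,n_k\to\infty .$$ -/

import Mathlib

open MeasureTheory Filter Topology

/-- A configuration in `X`: a countable subset of `X`. -/
@[ext]
structure Configuration (X : Type*) where
  /-- the set of points of the configuration -/
  points : Set X
  countable : points.Countable

namespace Configuration

variable {X : Type*}

/-- The set of configurations having exactly `n` points in `A`. -/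
def countEq (A : Set X) (n : ℕ) : Set (Configuration X) :=
  {s | (s.points ∩ A).encard = (n : ℕ∞)}

/-- The σ-algebra on configurations generated by the numbers of points in measurable sets. -/
instance instMeasurableSpace [MeasurableSpace X] : MeasurableSpace (Configuration X) :=
  MeasurableSpace.generateFrom
    {V | ∃ (A : Set X) (n : ℕ), MeasurableSet A ∧ V = countEq A n}

end Configuration

/-- `ν` is the Poisson measure with intensity `μ` on the configuration space: for pairwise disjoint
measurable sets `A i` of finite measure, the numbers of points in the `A i` are independent and
Poisson distributed with parameters `μ (A i)`. -/
def IsPoissonMeasure {X : Type*} [MeasurableSpace X] (μ : Measure X)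
    (ν : Measure (Configuration X)) : Prop :=
  ∀ (N : ℕ) (A : Fin N → Set X), (∀ i, MeasurableSet (A i)) → (∀ i, μ (A i) < ⊤) →
    Pairwise (fun i j => Disjoint (A i) (A j)) → ∀ n : Fin N → ℕ,
      ν (⋂ i, Configuration.countEq (A i) (n i)) =
        ENNReal.ofReal (∏ i, Real.exp (-(μ (A i)).toReal) * (μ (A i)).toReal ^ n i
          / (Nat.factorial (n i) : ℝ))

/-- The Poisson suspension of `T`: it moves every point of a configuration by `T`. -/
def poissonSuspension {X : Type*} (T : X → X) (s : Configuration X) : Configuration X :=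
  ⟨T '' s.points, s.countable.image T⟩

/-- Mixing: `ν (Sⁿ V ∩ W) → ν V * ν W` for all measurable `V`, `W`. (It is used for invertible,
measure-preserving `S`.) -/
def IsMixing {Ω : Type*} [MeasurableSpace Ω] (ν : Measure Ω) (S : Ω → Ω) : Prop :=
  ∀ V W : Set Ω, MeasurableSet V → MeasurableSet W →
    Tendsto (fun n : ℕ => ν ((S^[n] '' V) ∩ W)) atTop (𝓝 (ν V * ν W))

/-- Mixing of order `k`: for all measurable `A 0, …, A k`,
`ν (A 0 ∩ S ^ (n₁) (A 1) ∩ S ^ (n₁ + n₂) (A 2) ∩ ⋯ ∩ S ^ (n₁ + ⋯ + n_k) (A k))` tends to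
`ν (A 0) * ⋯ * ν (A k)` as all of `n₁, …, n_k` tend to infinity. (It is used for invertible,
measure-preserving `S`.) -/
def IsMixingOfOrder {Ω : Type*} [MeasurableSpace Ω] (ν : Measure Ω) (S : Ω → Ω) (k : ℕ) : Prop :=
  ∀ A : Fin (k + 1) → Set Ω, (∀ i, MeasurableSet (A i)) →
    Tendsto
      (fun n : Fin k → ℕ =>
        ν (⋂ i : Fin (k + 1), S^[∑ j : Fin k with j.castSucc < i, n j] '' A i))
      (Filter.pi fun _ => atTop) (𝓝 (∏ i, ν (A i)))

/-! Mixing of `T_*` is used only on void events. The configuration misses both `TⁿA` and `B` with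
probability `exp(-μ(TⁿA ∪ B))`, and mixing forces this to tend to `exp(-μ A - μ B)`; hence `μ(TⁿA ∩
B) → 0` for `A`, `B` of finite measure (`tendsto_measure_preimage_iterate_inter`).

Now take events given by counts in finitely many sets of finite measure. Their translates at widely
separated times concern sets with nearly null overlaps. Deleting the overlap `O` changes
probabilities by at most `1 - exp(-μ O) ≤ μ O`, and after deletion the Poisson property makes the
events exactly independent (`measure_iInter_groups`, `tendsto_measureReal_iInter`). Such events form
a generating π-system, and the limit extends to all measurable sets one coordinate at a time
(`tendsto_measureReal_iInter_preimage_of_isPiSystem`). -/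

namespace Configuration

/-! ### Counts of points and a generating π-system -/

variable {X : Type*}

/-- The number of points of a configuration in `A`. -/
noncomputable def count (A : Set X) (s : Configuration X) : ℕ∞ := (s.points ∩ A).encard

theorem countEq_eq_preimage (A : Set X) (n : ℕ) : countEq A n = count A ⁻¹' {(n : ℕ∞)} := rfl

theorem count_mono {A B : Set X} (h : A ⊆ B) (s : Configuration X) : count A s ≤ count B s :=
  Set.encard_le_encard (Set.inter_subset_inter_right _ h)

/-- The set of points that belong to exactly those `B j` with `j ∈ S`. -/
def cell {J : Type*} (B : J → Set X) (S : Finset J) : Set X := {x | ∀ j, x ∈ B j ↔ j ∈ S}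

theorem disjoint_cell {J : Type*} (B : J → Set X) {S S' : Finset J} (h : S ≠ S') :
    Disjoint (cell B S) (cell B S') :=
  Set.disjoint_left.2 fun _ hx hx' => h (Finset.ext fun j => (hx j).symm.trans (hx' j))

theorem cell_subset {J : Type*} (B : J → Set X) {S : Finset J} {j : J} (hj : j ∈ S) :
    cell B S ⊆ B j := fun _ hx => (hx j).2 hj

-- Sorting points by the exact set of indices `j` with `x ∈ B j` reduces overlapping sets to
-- disjoint ones.
open Classical in
theorem count_eq_sum_cell {J : Type*} [Fintype J] (B : J → Set X) (j : J) (s : Configuration X) :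
    count (B j) s = ∑ S : {S : Finset J // S.Nonempty},
      if j ∈ S.1 then count (cell B S.1) s else 0 := by
  have h : s.points ∩ B j = ⋃ S : {S : Finset J // S.Nonempty},
      if j ∈ S.1 then s.points ∩ cell B S.1 else ∅ := by
    ext x
    simp only [Set.mem_iUnion, Set.mem_inter_iff]
    constructor
    · rintro ⟨hx, hj⟩
      refine ⟨⟨Finset.univ.filter (fun j => x ∈ B j), j, by simpa using hj⟩, ?_⟩
      simp [hj, hx, cell]
    · rintro ⟨S, hS⟩
      split_ifs at hS with hj
      · exact ⟨hS.1, cell_subset B hj hS.2⟩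
      · exact hS.elim
  rw [count, h, Set.encard_iUnion_of_finite, finsum_eq_sum_of_fintype]
  · refine Finset.sum_congr rfl fun S _ => ?_
    split_ifs <;> simp [count]
  · intro S S' hne
    have := (disjoint_cell B (Subtype.coe_injective.ne hne)).mono
      (Set.inter_subset_right (s := s.points)) (Set.inter_subset_right (s := s.points))
    dsimp only [Function.onFun]
    split_ifs <;> simp [this]

/-- Finitely many witnesses each enter at some stage, so a common stage contains them all. -/
theorem natCast_le_count_iUnion_iff {A : ℕ → Set X} (hA : Monotone A) (s : Configuration X)
    (n : ℕ) : (n : ℕ∞) ≤ count (⋃ k, A k) s ↔ ∃ k, (n : ℕ∞) ≤ count (A k) s := by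
  refine ⟨fun hn => ?_, fun ⟨k, hk⟩ => hk.trans (count_mono (Set.subset_iUnion A k) s)⟩
  obtain ⟨t, ht, htn⟩ := Set.exists_subset_encard_eq hn
  have hmem (x : X) (hx : x ∈ t) : ∃ k, x ∈ A k := Set.mem_iUnion.1 (ht hx).2
  choose! f hf using hmem
  obtain ⟨k, hk⟩ := ((Set.finite_of_encard_eq_coe htn).image f).bddAbove
  exact ⟨k, htn ▸ Set.encard_le_encard fun x hx =>
    ⟨(ht hx).1, hA (hk (Set.mem_image_of_mem f hx)) (hf x hx)⟩⟩

variable [MeasurableSpace X]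

theorem measurableSet_cell {J : Type*} [Countable J] {B : J → Set X}
    (hB : ∀ j, MeasurableSet (B j)) (S : Finset J) : MeasurableSet (cell B S) := by
  have : cell B S = ⋂ j, {x | x ∈ B j ↔ j ∈ S} := by ext; simp [cell]
  rw [this]
  refine MeasurableSet.iInter fun j => ?_
  by_cases hj : j ∈ S
  · simpa [hj] using hB j
  · simpa only [hj, iff_false] using! (hB j).compl

theorem measurableSet_countEq {A : Set X} (hA : MeasurableSet A) (n : ℕ) :
    MeasurableSet (countEq A n) :=
  MeasurableSpace.measurableSet_generateFrom ⟨A, n, hA, rfl⟩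

theorem measurable_of_measurableSet_preimage_natCast {Ω : Type*} {_ : MeasurableSpace Ω}
    {f : Ω → ℕ∞} (hf : ∀ n : ℕ, MeasurableSet (f ⁻¹' {(n : ℕ∞)})) : Measurable f := by
  refine measurable_to_countable' fun n => ?_
  induction n using ENat.recTopCoe with
  | coe n => exact hf n
  | top =>
    have : f ⁻¹' {⊤} = (⋃ n : ℕ, f ⁻¹' {(n : ℕ∞)})ᶜ := by
      ext s
      cases h : f s using ENat.recTopCoe <;> simp [h]
    rw [this]
    exact (MeasurableSet.iUnion hf).compl

theorem measurable_count {A : Set X} (hA : MeasurableSet A) : Measurable (count A) :=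
  measurable_of_measurableSet_preimage_natCast fun n => measurableSet_countEq hA n

/-- Finite intersections of events prescribing the number of points in a set of finite measure. -/
def finiteCountEvents (μ : Measure X) : Set (Set (Configuration X)) :=
  {V | ∃ (J : Type) (_ : Fintype J) (B : J → Set X) (n : J → ℕ),
    (∀ j, MeasurableSet (B j)) ∧ (∀ j, μ (B j) < ⊤) ∧ V = ⋂ j, countEq (B j) (n j)}

theorem isPiSystem_finiteCountEvents (μ : Measure X) : IsPiSystem (finiteCountEvents μ) := by
  rintro _ ⟨J, _, B, n, hB, hB', rfl⟩ _ ⟨J', _, B', n', h, h', rfl⟩ -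
  refine ⟨J ⊕ J', inferInstance, Sum.elim B B', Sum.elim n n', ?_, ?_, ?_⟩
  · rintro (j | j) <;> simp [*]
  · rintro (j | j) <;> simp [*]
  · simp [Set.iInter_sum]

theorem univ_mem_finiteCountEvents (μ : Measure X) : Set.univ ∈ finiteCountEvents μ :=
  ⟨Empty, inferInstance, Empty.elim, Empty.elim, by simp, by simp, by simp⟩

/-- By σ-finiteness any `A` is exhausted by sets of finite measure; it holds `n` points iff some
stage reaches `n` and none reaches `n + 1`. -/
theorem generateFrom_finiteCountEvents (μ : Measure X) [SigmaFinite μ] :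
    instMeasurableSpace = MeasurableSpace.generateFrom (finiteCountEvents μ) := by
  refine le_antisymm (MeasurableSpace.generateFrom_le ?_) (MeasurableSpace.generateFrom_le ?_)
  · rintro _ ⟨A, n, hA, rfl⟩
    have hm : Monotone fun k => A ∩ spanningSets μ k := fun k l h =>
      Set.inter_subset_inter_right _ (monotone_spanningSets μ h)
    have hcount : countEq A n = (⋃ k, count (A ∩ spanningSets μ k) ⁻¹' Set.Ici (n : ℕ∞)) \
        ⋃ k, count (A ∩ spanningSets μ k) ⁻¹' Set.Ici ((n + 1 : ℕ) : ℕ∞) := by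
      ext s
      simp only [Set.mem_sdiff, Set.mem_iUnion, Set.mem_preimage, Set.mem_Ici,
        ← natCast_le_count_iUnion_iff hm, ← Set.inter_iUnion, iUnion_spanningSets, Set.inter_univ]
      rw [countEq_eq_preimage, Set.mem_preimage, Set.mem_singleton_iff, not_le,
        Nat.cast_add, Nat.cast_one, ENat.lt_add_one_iff (ENat.natCast_ne_top n)]
      exact ⟨fun h => ⟨h.ge, h.le⟩, fun h => h.2.antisymm h.1⟩
    rw [hcount]
    have hk (k : ℕ) : @Measurable _ _ (MeasurableSpace.generateFrom (finiteCountEvents μ)) _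
        (count (A ∩ spanningSets μ k)) := by
      refine @measurable_of_measurableSet_preimage_natCast _
        (MeasurableSpace.generateFrom (finiteCountEvents μ)) _ fun n =>
          MeasurableSpace.measurableSet_generateFrom
            ⟨Unit, inferInstance, fun _ => A ∩ spanningSets μ k, fun _ => n,
              fun _ => hA.inter (measurableSet_spanningSets μ k), fun _ => ?_, ?_⟩
      · exact (measure_mono Set.inter_subset_right).trans_lt (measure_spanningSets_lt_top μ k)
      · simp only [Set.iInter_const, countEq_eq_preimage]
    exact MeasurableSet.diff (.iUnion fun k => hk k .of_discrete) (.iUnion fun k => hk k .of_discrete)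
  · rintro _ ⟨J, _, B, n, hB, -, rfl⟩
    exact MeasurableSet.iInter fun j => measurableSet_countEq (hB j) _

end Configuration

/-! ### Independence and asymptotic independence of counts -/

open ProbabilityTheory in
theorem iIndepFun_of_measure_iInter_singleton {Ω ι : Type*} [MeasurableSpace Ω] [Fintype ι]
    {ν : Measure Ω} [IsProbabilityMeasure ν] {β : ι → Type*} [∀ i, Countable (β i)]
    [∀ i, MeasurableSpace (β i)] [∀ i, MeasurableSingletonClass (β i)]
    {f : ∀ i, Ω → β i} (hf : ∀ i, Measurable (f i))
    (h : ∀ b : ∀ i, β i, ν (⋂ i, f i ⁻¹' {b i}) = ∏ i, ν (f i ⁻¹' {b i})) : iIndepFun f ν := by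
  have (i : ι) : IsProbabilityMeasure (ν.map (f i)) :=
    Measure.isProbabilityMeasure_map (hf i).aemeasurable
  rw [iIndepFun_iff_map_fun_eq_pi_map fun i => (hf i).aemeasurable]
  refine Measure.ext_of_singleton fun b => ?_
  rw [Measure.pi_singleton, Measure.map_apply (measurable_pi_lambda _ hf) (measurableSet_singleton _)]
  simp_rw [Measure.map_apply (hf _) (measurableSet_singleton _)]
  rw [← h b]
  congr 1
  ext ω
  simp [funext_iff]

namespace IsPoissonMeasure

open Configuration

variable {X : Type*} [MeasurableSpace X] {μ : Measure X} {ν : Measure (Configuration X)}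

theorem isProbabilityMeasure (h : IsPoissonMeasure μ ν) : IsProbabilityMeasure ν where
  measure_univ := by
    simpa using h 0 (fun i => i.elim0) (fun i => i.elim0) (fun i => i.elim0)
      (fun i => i.elim0) (fun i => i.elim0)

theorem measure_iInter_countEq (h : IsPoissonMeasure μ ν) {ι : Type*} [Fintype ι]
    {A : ι → Set X} (hA : ∀ i, MeasurableSet (A i)) (hμ : ∀ i, μ (A i) < ⊤)
    (hd : Pairwise fun i j => Disjoint (A i) (A j)) (n : ι → ℕ) :
    ν (⋂ i, countEq (A i) (n i)) =
      ENNReal.ofReal (∏ i, Real.exp (-(μ (A i)).toReal) * (μ (A i)).toReal ^ n i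
        / (Nat.factorial (n i) : ℝ)) := by
  let e := (Fintype.equivFin ι).symm
  have := h (Fintype.card ι) (A ∘ e) (fun _ => hA _) (fun _ => hμ _)
    (fun i j hij => hd (e.injective.ne hij)) (n ∘ e)
  rw [← e.surjective.iInter_comp fun i => countEq (A i) (n i), ← e.prod_comp]
  exact this

theorem measure_countEq (h : IsPoissonMeasure μ ν) {A : Set X} (hA : MeasurableSet A)
    (hμ : μ A < ⊤) (n : ℕ) :
    ν (countEq A n) = ENNReal.ofReal
      (Real.exp (-(μ A).toReal) * (μ A).toReal ^ n / (Nat.factorial n : ℝ)) := by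
  simpa only [Set.iInter_const, Finset.univ_unique, Finset.prod_singleton] using
    h.measure_iInter_countEq (ι := Unit) (A := fun _ => A) (fun _ => hA) (fun _ => hμ)
    (fun i j hij => (hij (Subsingleton.elim i j)).elim) fun _ => n

theorem measureReal_countEq_zero (h : IsPoissonMeasure μ ν) {A : Set X} (hA : MeasurableSet A)
    (hμ : μ A < ⊤) : ν.real (countEq A 0) = Real.exp (-μ.real A) := by
  rw [Measure.real, h.measure_countEq hA hμ, ENNReal.toReal_ofReal (by positivity)]
  simp [Measure.real]

/-- The Poisson weights of the finite counts already sum to one. -/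
theorem measure_count_eq_top (h : IsPoissonMeasure μ ν) {A : Set X} (hA : MeasurableSet A)
    (hμ : μ A < ⊤) : ν (count A ⁻¹' {⊤}) = 0 := by
  have := h.isProbabilityMeasure
  have hc : count A ⁻¹' {⊤} = (⋃ n, countEq A n)ᶜ := by
    ext s
    cases h : count A s using ENat.recTopCoe <;> simp [countEq_eq_preimage, h]
  have hU : MeasurableSet (⋃ n, countEq A n) := .iUnion fun n => measurableSet_countEq hA n
  rw [hc, prob_compl_eq_zero_iff hU, measure_iUnion _ fun n => measurableSet_countEq hA n]
  · simp_rw [h.measure_countEq hA hμ]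
    have hs := ProbabilityTheory.hasSum_one_poissonMeasure (μ A).toNNReal
    simp only [ENNReal.coe_toNNReal_eq_toReal] at hs
    rw [← ENNReal.ofReal_tsum_of_nonneg (fun n => by positivity) hs.summable, hs.tsum_eq,
      ENNReal.ofReal_one]
  · intro m n hmn
    refine Set.disjoint_left.2 fun s hm hn => hmn ?_
    exact Nat.cast_injective (R := ℕ∞) (Eq.trans (Eq.symm hm) hn)

theorem measure_iInter_count_eq (h : IsPoissonMeasure μ ν) {ι : Type*} [Fintype ι]
    {A : ι → Set X} (hA : ∀ i, MeasurableSet (A i)) (hμ : ∀ i, μ (A i) < ⊤)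
    (hd : Pairwise fun i j => Disjoint (A i) (A j)) (b : ι → ℕ∞) :
    ν (⋂ i, count (A i) ⁻¹' {b i}) = ∏ i, ν (count (A i) ⁻¹' {b i}) := by
  by_cases hb : ∃ i, b i = ⊤
  · obtain ⟨i, hi⟩ := hb
    have h0 := h.measure_count_eq_top (hA i) (hμ i)
    rw [← hi] at h0
    rw [Finset.prod_eq_zero (Finset.mem_univ i) h0]
    exact measure_mono_null (Set.iInter_subset _ i) h0
  · push Not at hb
    lift b to ι → ℕ using hb
    simp_rw [← countEq_eq_preimage]
    rw [h.measure_iInter_countEq hA hμ hd, ENNReal.ofReal_prod_of_nonneg fun i _ => by positivity]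
    exact Finset.prod_congr rfl fun i _ => (h.measure_countEq (hA i) (hμ i) _).symm

/-- Events about the numbers of points in disjoint groups of sets are independent. -/
theorem measure_iInter_groups (h : IsPoissonMeasure μ ν) {ι : Type*} [Fintype ι] {J : ι → Type*}
    [∀ i, Fintype (J i)] {B : ∀ i, J i → Set X} (hB : ∀ i j, MeasurableSet (B i j))
    (hμ : ∀ i j, μ (B i j) < ⊤)
    (hd : ∀ i i', i ≠ i' → ∀ j j', Disjoint (B i j) (B i' j')) (n : ∀ i, J i → ℕ) :
    ν (⋂ i, ⋂ j, countEq (B i j) (n i j)) = ∏ i, ν (⋂ j, countEq (B i j) (n i j)) := by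
  classical
  have := h.isProbabilityMeasure
  -- The empty index set is excluded: its cell lies outside every `B i j` and may have infinite
  -- measure.
  let κ (i : ι) := {S : Finset (J i) // S.Nonempty}
  let D (i : ι) (S : κ i) : Set X := cell (B i) S.1
  have hD (i : ι) (S : κ i) : MeasurableSet (D i S) := measurableSet_cell (hB i) _
  have hDμ (i : ι) (S : κ i) : μ (D i S) < ⊤ := by
    obtain ⟨j, hj⟩ := S.2
    exact (measure_mono (cell_subset (B i) hj)).trans_lt (hμ i j)
  have hDd (i : ι) : Pairwise fun S S' : κ i => Disjoint (D i S) (D i S') :=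
    fun S S' hne => disjoint_cell (B i) (Subtype.coe_injective.ne hne)
  let f (i : ι) (s : Configuration X) (S : κ i) : ℕ∞ := count (D i S) s
  have hf (i : ι) : Measurable (f i) := measurable_pi_lambda _ fun S => measurable_count (hD i S)
  have hpre (i : ι) (b : κ i → ℕ∞) : f i ⁻¹' {b} = ⋂ S, count (D i S) ⁻¹' {b S} := by
    ext s; simp [f, funext_iff]
  -- The cells of all groups together form one disjoint family, so the joint law factors on atoms.
  have hindep : ProbabilityTheory.iIndepFun f ν := by
    refine iIndepFun_of_measure_iInter_singleton hf fun b => ?_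
    simp_rw [hpre]
    have hσ := h.measure_iInter_count_eq (ι := Σ i, κ i) (A := fun p => D p.1 p.2)
      (fun p => hD _ _) (fun p => hDμ _ _) ?_ fun p => b p.1 p.2
    · rw [Set.iInter_sigma, Fintype.prod_sigma] at hσ
      rw [hσ]
      exact Finset.prod_congr rfl fun i _ =>
        (h.measure_iInter_count_eq (hD i) (hDμ i) (hDd i) (b i)).symm
    · rintro ⟨i, S⟩ ⟨i', S'⟩ hne
      by_cases hi : i = i'
      · subst hi
        exact hDd i fun hS => hne (congrArg (Sigma.mk i) hS)
      · obtain ⟨j, hj⟩ := S.2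
        obtain ⟨j', hj'⟩ := S'.2
        exact (hd i i' hi j j').mono (cell_subset _ hj) (cell_subset _ hj')
  refine hindep.meas_iInter fun i => ?_
  -- Each event of group `i` is a condition on the vector of cell counts, measurable because that
  -- vector takes values in a countable space.
  refine ⟨{v | ∀ j, ∑ S : κ i, (if j ∈ S.1 then v S else 0) = (n i j : ℕ∞)},
    (Set.to_countable _).measurableSet, ?_⟩
  ext s
  simp only [Set.mem_preimage, Set.mem_ofPred_eq, Set.mem_iInter, countEq_eq_preimage,
    Set.mem_singleton_iff, count_eq_sum_cell (B i), f, D, κ]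

/-- Removing a set `O` from the sets `B j` changes an event about the counts only when the
configuration meets `O`. -/
theorem abs_measureReal_sub_le (h : IsPoissonMeasure μ ν) {J : Type*} [Fintype J] {B : J → Set X}
    (hB : ∀ j, MeasurableSet (B j)) {O : Set X} (hO : MeasurableSet O) (hOμ : μ O < ⊤)
    (n : J → ℕ) :
    |ν.real (⋂ j, countEq (B j \ O) (n j)) - ν.real (⋂ j, countEq (B j) (n j))| ≤ μ.real O := by
  have := h.isProbabilityMeasure
  refine (abs_measureReal_sub_le_measureReal_symmDiff
    (MeasurableSet.iInter fun j => measurableSet_countEq ((hB j).diff hO) _).nullMeasurableSet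
    (MeasurableSet.iInter fun j => measurableSet_countEq (hB j) _).nullMeasurableSet).trans ?_
  refine (measureReal_mono (s₂ := (countEq O 0)ᶜ) fun s hs hs0 => ?_).trans ?_
  · have hs0' : s.points ∩ O = ∅ := Set.encard_eq_zero.1 hs0
    have heq (j : J) : s.points ∩ (B j \ O) = s.points ∩ B j := by
      ext x
      exact ⟨fun hx => ⟨hx.1, hx.2.1⟩, fun hx => ⟨hx.1, hx.2, fun hxO => hs0'.le ⟨hx.1, hxO⟩⟩⟩
    have : s ∈ ⋂ j, countEq (B j \ O) (n j) ↔ s ∈ ⋂ j, countEq (B j) (n j) := by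
      simp only [Set.mem_iInter, countEq, Set.mem_ofPred_eq, heq]
    rcases hs with hs | hs
    · exact hs.2 (this.1 hs.1)
    · exact hs.2 (this.2 hs.1)
  · rw [probReal_compl_eq_one_sub (measurableSet_countEq hO 0), h.measureReal_countEq_zero hO hOμ]
    linarith [Real.add_one_le_exp (-μ.real O)]

/-- Groups of sets with asymptotically negligible overlaps give asymptotically independent
events. -/
theorem tendsto_measureReal_iInter (h : IsPoissonMeasure μ ν) {ι α : Type*} [Fintype ι]
    {l : Filter α} {J : ι → Type*} [∀ i, Fintype (J i)] {B : α → ∀ i, J i → Set X}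
    (hB : ∀ a i j, MeasurableSet (B a i j)) {G : α → ι → Set X}
    (hG : ∀ a i, MeasurableSet (G a i)) (hGμ : ∀ a i, μ (G a i) < ⊤)
    (hBG : ∀ a i j, B a i j ⊆ G a i)
    (hoverlap : ∀ i i', i ≠ i' → Tendsto (fun a => μ (G a i ∩ G a i')) l (𝓝 0))
    (n : ∀ i, J i → ℕ) {p : ι → ℝ}
    (hp : ∀ i, Tendsto (fun a => ν.real (⋂ j, countEq (B a i j) (n i j))) l (𝓝 (p i))) :
    Tendsto (fun a => ν.real (⋂ i, ⋂ j, countEq (B a i j) (n i j))) l (𝓝 (∏ i, p i)) := by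
  classical
  -- The points lying in at least two of the `G a i`; off this set the groups are disjoint.
  let O (a : α) : Set X := ⋃ q : {q : ι × ι // q.1 ≠ q.2}, G a q.1.1 ∩ G a q.1.2
  have hO (a : α) : MeasurableSet (O a) := .iUnion fun q => (hG _ _).inter (hG _ _)
  have hOle (a : α) : μ (O a) ≤ ∑ q : {q : ι × ι // q.1 ≠ q.2}, μ (G a q.1.1 ∩ G a q.1.2) :=
    measure_iUnion_fintype_le _ _
  have hOμ (a : α) : μ (O a) < ⊤ := (hOle a).trans_lt <| ENNReal.sum_lt_top.2 fun q _ =>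
    (measure_mono Set.inter_subset_left).trans_lt (hGμ _ _)
  have hO0 : Tendsto (fun a => μ.real (O a)) l (𝓝 0) := by
    have h0 : Tendsto (fun a => μ (O a)) l (𝓝 0) := by
      refine tendsto_of_tendsto_of_tendsto_of_le_of_le tendsto_const_nhds ?_
        (fun _ => zero_le) hOle
      simpa using tendsto_finsetSum Finset.univ
        fun (q : {q : ι × ι // q.1 ≠ q.2}) _ => hoverlap q.1.1 q.1.2 q.2
    exact (ENNReal.tendsto_toReal ENNReal.zero_ne_top).comp h0
  have key (a : α) : ν.real (⋂ i, ⋂ j, countEq (B a i j \ O a) (n i j)) =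
      ∏ i, ν.real (⋂ j, countEq (B a i j \ O a) (n i j)) := by
    simp only [Measure.real]
    rw [h.measure_iInter_groups (fun i j => (hB a i j).diff (hO a)) _ _ n, ENNReal.toReal_prod]
    · exact fun i j => (measure_mono (Set.sdiff_subset.trans (hBG a i j))).trans_lt (hGμ a i)
    · intro i i' hne j j'
      refine Set.disjoint_left.2 fun x hx hx' => hx.2 ?_
      exact Set.mem_iUnion.2 ⟨⟨(i, i'), hne⟩, hBG a i j hx.1, hBG a i' j' hx'.1⟩
  have hp' (i : ι) :
      Tendsto (fun a => ν.real (⋂ j, countEq (B a i j \ O a) (n i j))) l (𝓝 (p i)) := by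
    have hz : Tendsto (fun a => ν.real (⋂ j, countEq (B a i j \ O a) (n i j)) -
        ν.real (⋂ j, countEq (B a i j) (n i j))) l (𝓝 0) :=
      squeeze_zero_norm (fun a => h.abs_measureReal_sub_le (hB a i) (hO a) (hOμ a) (n i)) hO0
    simpa using hz.add (hp i)
  have hprod := tendsto_finsetProd Finset.univ fun i _ => hp' i
  have hz : Tendsto (fun a => ν.real (⋂ i, ⋂ j, countEq (B a i j \ O a) (n i j)) -
      ν.real (⋂ i, ⋂ j, countEq (B a i j) (n i j))) l (𝓝 0) := by
    refine squeeze_zero_norm (fun a => ?_) hO0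
    -- The same bound applies to the full intersection, viewed as one family indexed by pairs.
    have := h.abs_measureReal_sub_le (J := Σ i, J i) (B := fun q => B a q.1 q.2)
      (fun q => hB a _ _) (hO a) (hOμ a) fun q => n q.1 q.2
    simpa only [Set.iInter_sigma, Real.norm_eq_abs] using this
  simpa [key] using hprod.sub hz

end IsPoissonMeasure

/-! ### Extending limits from a π-system -/

theorem tendsto_measureReal_preimage_inter_of_isPiSystem {Ω α : Type*} [m : MeasurableSpace Ω]
    {ν : Measure Ω} [IsFiniteMeasure ν] {C : Set (Set Ω)} (hC : IsPiSystem C)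
    (hgen : m = MeasurableSpace.generateFrom C) {l : Filter α} {g : α → Ω → Ω}
    (hg : ∀ a, MeasurePreserving (g a) ν ν) {R : α → Set Ω} (hR : ∀ a, MeasurableSet (R a)) {c : ℝ}
    (huniv : Tendsto (fun a => ν.real (g a ⁻¹' Set.univ ∩ R a)) l (𝓝 (ν.real Set.univ * c)))
    (hlim : ∀ V ∈ C, Tendsto (fun a => ν.real (g a ⁻¹' V ∩ R a)) l (𝓝 (ν.real V * c)))
    {V : Set Ω} (hV : MeasurableSet V) :
    Tendsto (fun a => ν.real (g a ⁻¹' V ∩ R a)) l (𝓝 (ν.real V * c)) := by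
  induction V, hV using MeasurableSpace.induction_on_inter hgen hC with
  | empty => simpa using tendsto_const_nhds
  | basic V hV => exact hlim V hV
  | compl V hV ih =>
    have heq (a : α) : ν.real (g a ⁻¹' Vᶜ ∩ R a) =
        ν.real (g a ⁻¹' Set.univ ∩ R a) - ν.real (g a ⁻¹' V ∩ R a) := by
      rw [← measureReal_sdiff (Set.inter_subset_inter_left _ (Set.preimage_mono V.subset_univ))
        (((hg a).measurable hV).inter (hR a))]
      congr 1
      ext
      simp only [Set.mem_inter_iff, Set.mem_preimage, Set.mem_compl_iff, Set.mem_sdiff,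
        Set.mem_univ]
      tauto
    simp_rw [heq]
    rw [measureReal_compl hV, sub_mul]
    exact huniv.sub ih
  | iUnion V hd hV ih =>
    have hsum (W : ℕ → Set Ω) (hWd : Pairwise (Function.onFun Disjoint W))
        (hW : ∀ i, MeasurableSet (W i)) : HasSum (fun i => ν.real (W i)) (ν.real (⋃ i, W i)) := by
      have hne : ∑' i, ν (W i) ≠ ⊤ := measure_iUnion hWd hW ▸ measure_ne_top ν _
      rw [measureReal_def, measure_iUnion hWd hW, ENNReal.tsum_toReal_eq fun i => measure_ne_top ν _]
      exact ENNReal.hasSum_toReal hne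
    have heq (a : α) : ν.real (g a ⁻¹' (⋃ i, V i) ∩ R a) = ∑' i, ν.real (g a ⁻¹' V i ∩ R a) := by
      rw [Set.preimage_iUnion, Set.iUnion_inter]
      exact (hsum _ (fun i j hij => ((hd hij).preimage _).mono Set.inter_subset_left
        Set.inter_subset_left) fun i => ((hg a).measurable (hV i)).inter (hR a)).tsum_eq.symm
    simp_rw [heq]
    rw [← ((hsum V hd hV).mul_right c).tsum_eq]
    -- Invariance of `ν` gives the dominating series `ν (V i)`, uniformly in `a`.
    refine tendsto_tsum_of_dominated_convergence (hsum V hd hV).summable ih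
      (Eventually.of_forall fun a i => ?_)
    rw [Real.norm_of_nonneg measureReal_nonneg, ← (hg a).measureReal_preimage (hV i).nullMeasurableSet]
    exact measureReal_mono Set.inter_subset_left

theorem tendsto_measureReal_iInter_preimage_of_isPiSystem {Ω α ι : Type*} [Finite ι]
    [m : MeasurableSpace Ω] {ν : Measure Ω} [IsProbabilityMeasure ν] {C : Set (Set Ω)}
    (hC : IsPiSystem C) (huniv : Set.univ ∈ C) (hgen : m = MeasurableSpace.generateFrom C)
    {l : Filter α} {g : α → ι → Ω → Ω} (hg : ∀ a i, MeasurePreserving (g a i) ν ν)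
    (hlim : ∀ V : ι → Set Ω, (∀ i, V i ∈ C) →
      Tendsto (fun a => ν.real (⋂ i, g a i ⁻¹' V i)) l (𝓝 (∏ᶠ i, ν.real (V i))))
    (V : ι → Set Ω) (hV : ∀ i, MeasurableSet (V i)) :
    Tendsto (fun a => ν.real (⋂ i, g a i ⁻¹' V i)) l (𝓝 (∏ᶠ i, ν.real (V i))) := by
  classical
  cases nonempty_fintype ι
  simp only [finprod_eq_prod_of_fintype] at hlim ⊢
  have hCm (W : Set Ω) (hW : W ∈ C) : MeasurableSet W := by
    rw [hgen]; exact MeasurableSpace.measurableSet_generateFrom hW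
  -- Induction on the set `s` of coordinates already allowed arbitrary measurable sets; the others
  -- stay in `C`.
  suffices H : ∀ (s : Finset ι) (V : ι → Set Ω), (∀ i ∈ s, MeasurableSet (V i)) →
      (∀ i ∉ s, V i ∈ C) →
      Tendsto (fun a => ν.real (⋂ i, g a i ⁻¹' V i)) l (𝓝 (∏ i, ν.real (V i))) from
    H Finset.univ V (fun i _ => hV i) fun i hi => (hi (Finset.mem_univ i)).elim
  intro s
  induction s using Finset.induction_on with
  | empty => exact fun V _ h => hlim V fun i => h i (Finset.notMem_empty i)
  | insert i₀ s hi₀ ih =>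
    intro V hVm hVC
    have hVm' (i : ι) : MeasurableSet (V i) := by
      by_cases hi : i ∈ insert i₀ s
      exacts [hVm i hi, hCm _ (hVC i hi)]
    let R (a : α) : Set Ω := ⋂ i, ⋂ _ : i ≠ i₀, g a i ⁻¹' V i
    have hR (a : α) : MeasurableSet (R a) :=
      .iInter fun i => .iInter fun _ => (hg a i).measurable (hVm' i)
    have hsplit (a : α) (W : Set Ω) :
        ⋂ i, g a i ⁻¹' Function.update V i₀ W i = g a i₀ ⁻¹' W ∩ R a := by
      ext ω
      simp only [Set.mem_iInter, Set.mem_inter_iff, R]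
      refine ⟨fun h => ⟨by simpa using h i₀, fun i hi => by simpa [hi] using h i⟩, fun h i => ?_⟩
      by_cases hi : i = i₀
      · subst hi; simpa using h.1
      · simpa [hi] using h.2 i hi
    have hprod (W : Set Ω) : ∏ i, ν.real (Function.update V i₀ W i) =
        ν.real W * ∏ i ∈ Finset.univ.erase i₀, ν.real (V i) := by
      rw [← Finset.mul_prod_erase _ _ (Finset.mem_univ i₀), Function.update_self]
      congr 1
      exact Finset.prod_congr rfl fun i hi => by
        rw [Function.update_of_ne (Finset.ne_of_mem_erase hi)]
    have hstep (W : Set Ω) (hW : W ∈ C) : Tendsto (fun a => ν.real (g a i₀ ⁻¹' W ∩ R a)) l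
        (𝓝 (ν.real W * ∏ i ∈ Finset.univ.erase i₀, ν.real (V i))) := by
      simp_rw [← hsplit, ← hprod]
      refine ih _ (fun i hi => ?_) fun i hi => ?_
      · rw [Function.update_of_ne (ne_of_mem_of_not_mem hi hi₀)]
        exact hVm' i
      · by_cases h : i = i₀
        · subst h; simpa using hW
        · rw [Function.update_of_ne h]
          exact hVC i (by simp [h, hi])
    have := tendsto_measureReal_preimage_inter_of_isPiSystem hC hgen (fun a => hg a i₀) hR
      (hstep _ huniv) hstep (hVm' i₀)
    simpa only [← hsplit, ← hprod, Function.update_eq_self] using this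

/-- Mixing against the whole space gives `ν (S'⁻ⁿ V) → ν V`. For `S'⁻¹ V` the sequence is the same
one shifted, so the limits agree. -/
theorem IsMixing.measurePreserving {Ω : Type*} [MeasurableSpace Ω] {ν : Measure Ω}
    [IsProbabilityMeasure ν] {S S' : Ω → Ω} (hS : IsMixing ν S) (hm : Measurable S')
    (hl : Function.LeftInverse S' S) (hr : Function.RightInverse S' S) :
    MeasurePreserving S' ν ν := by
  refine ⟨hm, Measure.ext fun V hV => ?_⟩
  rw [Measure.map_apply hm hV]
  have h (W : Set Ω) (hW : MeasurableSet W) :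
      Tendsto (fun n : ℕ => ν (S'^[n] ⁻¹' W)) atTop (𝓝 (ν W)) := by
    simpa [Set.image_eq_preimage_of_inverse (hl.iterate _) (hr.iterate _)]
      using hS W Set.univ hW .univ
  refine tendsto_nhds_unique (h _ (hm hV)) ?_
  have h1 := (h V hV).comp (tendsto_add_atTop_nat 1)
  refine h1.congr fun n => ?_
  rw [Function.comp_apply, ← Set.preimage_comp, ← Function.iterate_succ']

/-! ### The suspension, and vanishing overlaps from mixing -/

section Suspension

open Configuration

variable {X : Type*}

theorem poissonSuspension_comp (f g : X → X) :
    poissonSuspension (f ∘ g) = poissonSuspension f ∘ poissonSuspension g := by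
  ext1 s
  ext1
  exact Set.image_comp f g s.points

theorem poissonSuspension_id : poissonSuspension (id : X → X) = id := by
  ext1 s
  ext1
  exact Set.image_id s.points

theorem iterate_poissonSuspension (f : X → X) (n : ℕ) :
    (poissonSuspension f)^[n] = poissonSuspension f^[n] := by
  induction n with
  | zero => exact poissonSuspension_id.symm
  | succ n ih => rw [Function.iterate_succ, ih, ← poissonSuspension_comp, ← Function.iterate_succ]

theorem poissonSuspension_preimage_countEq {f : X → X} (hf : Function.Injective f) (A : Set X)
    (n : ℕ) : poissonSuspension f ⁻¹' countEq A n = countEq (f ⁻¹' A) n := by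
  ext s
  simp only [countEq, Set.mem_preimage, Set.mem_ofPred_eq, poissonSuspension]
  rw [← Set.image_inter_preimage, hf.encard_image]

theorem leftInverse_poissonSuspension {f g : X → X} (h : Function.LeftInverse f g) :
    Function.LeftInverse (poissonSuspension f) (poissonSuspension g) := fun s => by
  rw [← Function.comp_apply (f := poissonSuspension f), ← poissonSuspension_comp, h.comp_eq_id,
    poissonSuspension_id, id]

variable [MeasurableSpace X]

theorem measurable_poissonSuspension {f : X → X} (hf : Measurable f) (hinj : Function.Injective f) :
    Measurable (poissonSuspension f) := by
  refine measurable_generateFrom ?_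
  rintro _ ⟨A, n, hA, rfl⟩
  rw [poissonSuspension_preimage_countEq hinj]
  exact measurableSet_countEq (hf hA) n

theorem tendsto_measure_preimage_iterate_inter {μ : Measure X} {ν : Measure (Configuration X)}
    (h : IsPoissonMeasure μ ν) {T : X ≃ᵐ X} (hT : MeasurePreserving T.symm μ μ)
    (hmix : IsMixing ν (poissonSuspension T)) {A B : Set X} (hA : MeasurableSet A)
    (hB : MeasurableSet B) (hμA : μ A < ⊤) (hμB : μ B < ⊤) :
    Tendsto (fun n : ℕ => μ (T.symm^[n] ⁻¹' A ∩ B)) atTop (𝓝 0) := by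
  have := h.isProbabilityMeasure
  have hTn (n : ℕ) := hT.iterate n
  have hA' (n : ℕ) : MeasurableSet (T.symm^[n] ⁻¹' A) := (hTn n).measurable hA
  have hμA' (n : ℕ) : μ (T.symm^[n] ⁻¹' A) = μ A := (hTn n).measure_preimage hA.nullMeasurableSet
  have hfin (n : ℕ) : μ (T.symm^[n] ⁻¹' A ∪ B) < ⊤ :=
    measure_union_lt_top ((hμA' n).trans_lt hμA) hμB
  have hexp (n : ℕ) : ν ((poissonSuspension T)^[n] '' countEq A 0 ∩ countEq B 0) =
      ENNReal.ofReal (Real.exp (-μ.real (T.symm^[n] ⁻¹' A ∪ B))) := by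
    rw [← h.measureReal_countEq_zero ((hA' n).union hB) (hfin n), ofReal_measureReal,
      Set.image_eq_preimage_of_inverse
        ((leftInverse_poissonSuspension T.symm_apply_apply).iterate n)
        ((leftInverse_poissonSuspension T.apply_symm_apply).iterate n),
      iterate_poissonSuspension, poissonSuspension_preimage_countEq (T.symm.injective.iterate n)]
    congr 1
    ext s
    simp [countEq, Set.inter_union_distrib_left]
  have hlim := hmix _ _ (measurableSet_countEq hA 0) (measurableSet_countEq hB 0)
  simp_rw [hexp] at hlim
  -- The limit of the void probabilities is nonzero, so logarithms converge and return `μ` of the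
  -- union.
  have hlog := ((ENNReal.tendsto_toReal (by finiteness)).comp hlim).log
    (by
      rw [ENNReal.toReal_mul]
      change ν.real _ * ν.real _ ≠ 0
      rw [h.measureReal_countEq_zero hA hμA, h.measureReal_countEq_zero hB hμB]
      positivity)
  have hval : Real.log (ν (countEq A 0) * ν (countEq B 0)).toReal = -μ.real A + -μ.real B := by
    rw [ENNReal.toReal_mul]
    change Real.log (ν.real _ * ν.real _) = _
    rw [h.measureReal_countEq_zero hA hμA, h.measureReal_countEq_zero hB hμB, ← Real.exp_add,
      Real.log_exp]
  rw [hval] at hlog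
  have hz : Tendsto (fun n : ℕ => μ.real (T.symm^[n] ⁻¹' A ∩ B)) atTop (𝓝 0) := by
    have h0 := hlog.const_add (μ.real A + μ.real B)
    have h1 : μ.real A + μ.real B + (-μ.real A + -μ.real B) = 0 := by ring
    rw [h1] at h0
    refine h0.congr fun n => ?_
    have hadd := measureReal_union_add_inter (μ := μ) (s := T.symm^[n] ⁻¹' A) hB
      ((hμA' n).trans_lt hμA).ne hμB.ne
    have : μ.real (T.symm^[n] ⁻¹' A) = μ.real A := congrArg ENNReal.toReal (hμA' n)
    simp only [Function.comp_apply, ENNReal.toReal_ofReal (Real.exp_pos _).le, Real.log_exp]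
    linarith
  have := ENNReal.tendsto_ofReal hz
  rw [ENNReal.ofReal_zero] at this
  refine this.congr fun n => ENNReal.ofReal_toReal ?_
  exact ((measure_mono Set.inter_subset_right).trans_lt hμB).ne

end Suspension

/-! ### Mixing of all orders -/

theorem tendsto_sum_sub_sum {k : ℕ} {i i' : Fin (k + 1)} (h : i < i') :
    Tendsto (fun n : Fin k → ℕ => (∑ j : Fin k with j.castSucc < i', n j) -
      ∑ j : Fin k with j.castSucc < i, n j) (Filter.pi fun _ => atTop) atTop := by
  have hik : (i : ℕ) < k := by omega
  -- The summand with index `i` occurs in the larger sum but not in the smaller, so it bounds the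
  -- gap from below.
  refine tendsto_atTop_mono (fun n => ?_) (tendsto_eval_pi (fun _ : Fin k => atTop) ⟨i, hik⟩)
  refine Nat.le_sub_of_add_le ?_
  have hi : (⟨i, hik⟩ : Fin k) ∉ Finset.univ.filter fun j : Fin k => j.castSucc < i := by
    simp [Fin.lt_def]
  rw [Function.eval, ← Finset.sum_insert hi]
  refine Finset.sum_le_sum_of_subset fun j hj => ?_
  simp only [Finset.mem_insert, Finset.mem_filter, Finset.mem_univ, true_and] at hj ⊢
  rcases hj with rfl | hj
  exacts [h, hj.trans h]

theorem mainTheorem2 {X : Type*} [MeasurableSpace X] [StandardBorelSpace X]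
    (μ : Measure X) [SigmaFinite μ] [NullSingletonClass μ] (hμ : μ Set.univ = ⊤)
    (μstar : Measure (Configuration X)) (hPoisson : IsPoissonMeasure μ μstar)
    (T : X ≃ᵐ X) (hT : MeasurePreserving T μ μ)
    (hmix : IsMixing μstar (poissonSuspension T)) :
    ∀ k : ℕ, 1 ≤ k → IsMixingOfOrder μstar (poissonSuspension T) k := by
  intro k _ A hA
  have := hPoisson.isProbabilityMeasure
  have hT' : MeasurePreserving T.symm μ μ := hT.symm
  have hl := leftInverse_poissonSuspension T.symm_apply_apply
  have hr := leftInverse_poissonSuspension T.apply_symm_apply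
  have hP : MeasurePreserving (poissonSuspension T.symm) μstar μstar :=
    hmix.measurePreserving (measurable_poissonSuspension T.symm.measurable T.symm.injective) hl hr
  let N (n : Fin k → ℕ) (i : Fin (k + 1)) : ℕ := ∑ j : Fin k with j.castSucc < i, n j
  suffices H : Tendsto (fun n => μstar.real (⋂ i, (poissonSuspension T.symm)^[N n i] ⁻¹' A i))
      (Filter.pi fun _ => atTop) (𝓝 (∏ᶠ i, μstar.real (A i))) by
    have := ENNReal.tendsto_ofReal H
    simp only [finprod_eq_prod_of_fintype,
      Measure.real, ENNReal.ofReal_prod_of_nonneg fun _ _ => ENNReal.toReal_nonneg,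
      ENNReal.ofReal_toReal (measure_ne_top μstar _)] at this
    simpa only [Set.image_eq_preimage_of_inverse (hl.iterate _) (hr.iterate _)] using this
  refine tendsto_measureReal_iInter_preimage_of_isPiSystem
    (Configuration.isPiSystem_finiteCountEvents μ) (Configuration.univ_mem_finiteCountEvents μ)
    (Configuration.generateFrom_finiteCountEvents μ) (fun n i => hP.iterate _) (fun V hV => ?_) A hA
  choose J hJ B c hB hBμ hVeq using hV
  have hpre (m : ℕ) (i : Fin (k + 1)) : (poissonSuspension T.symm)^[m] ⁻¹' V i =
      ⋂ j, Configuration.countEq (T.symm^[m] ⁻¹' B i j) (c i j) := by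
    rw [hVeq, iterate_poissonSuspension, Set.preimage_iInter]
    simp_rw [poissonSuspension_preimage_countEq (T.symm.injective.iterate m)]
  simp_rw [hpre, finprod_eq_prod_of_fintype]
  let F (i : Fin (k + 1)) : Set X := ⋃ j, B i j
  have hF (i) : MeasurableSet (F i) := .iUnion (hB i)
  have hFμ (i) : μ (F i) < ⊤ := (measure_iUnion_fintype_le _ _).trans_lt <|
    ENNReal.sum_lt_top.2 fun j _ => hBμ i j
  have hoverlap (i i' : Fin (k + 1)) (h : i < i') :
      Tendsto (fun n => μ (T.symm^[N n i] ⁻¹' F i ∩ T.symm^[N n i'] ⁻¹' F i'))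
        (Filter.pi fun _ => atTop) (𝓝 0) := by
    -- Since `T.symm` preserves `μ`, the common `N n i` iterates drop out and only the gap `N n i' -
    -- N n i` matters.
    refine ((tendsto_measure_preimage_iterate_inter hPoisson hT' hmix (hF i') (hF i) (hFμ i')
      (hFμ i)).comp (tendsto_sum_sub_sum h)).congr fun n => ?_
    have hle : N n i ≤ N n i' := Finset.sum_le_sum_of_subset fun j hj => by
      simp only [Finset.mem_filter, Finset.mem_univ, true_and] at hj ⊢
      exact hj.trans h
    rw [Function.comp_apply, ← (hT'.iterate (N n i)).measure_preimage
      (((hT'.iterate _).measurable (hF i')).inter (hF i)).nullMeasurableSet, Set.preimage_inter,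
      ← Set.preimage_comp, ← Function.iterate_add, Nat.sub_add_cancel hle, Set.inter_comm]
  refine hPoisson.tendsto_measureReal_iInter
    (fun n i j => (hT'.iterate _).measurable (hB i j))
    (G := fun n i => T.symm^[N n i] ⁻¹' F i) (fun n i => (hT'.iterate _).measurable (hF i))
    (fun n i => ((hT'.iterate _).measure_preimage (hF i).nullMeasurableSet).trans_lt (hFμ i))
    (fun n i j => Set.preimage_mono (Set.subset_iUnion (B i) j)) (fun i i' hne => ?_) c fun i => ?_
  · rcases hne.lt_or_gt with h | h
    · exact hoverlap i i' h
    · simpa only [Set.inter_comm] using hoverlap i' i h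
  · have hVm : MeasurableSet (V i) := by
      rw [hVeq]
      exact .iInter fun j => Configuration.measurableSet_countEq (hB i j) _
    simp_rw [← hpre, (hP.iterate _).measureReal_preimage hVm.nullMeasurableSet]
    exact tendsto_const_nhds
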